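/- Let $K$ be a field, $d \ge 0$ an integer, and let $X \in \mathrm{Mat}_d(K)$ act on $V = K^d$ (row vectors, on the right). Write $V=\bigoplus_i U_i$ as a direct sum of nonzero $X$-invariant subspaces, none of which is a direct sum of two nonzero $X$-invariant subspaces. The minimum polynomial of $X$ on each $U_i$ is $f^t$ for some monic irreducible $f\in K[x]$ and some integer $t\ge 1$. For each monic irreducible $f$, let $\lambda_f$ be the partition (finite multiset of positive integers) formed by the values of $t$ arising from those $U_i$ on which the minimum polynomial is a power of $f$, counted with multiplicity; the partitions $\lambda_f$ do not depend on the chosen decomposition. Let $\Phi_X$ be the finite set of those monic irreducible $f$ for which $\lambda_f$ is non-empty. Two monic irreducible polynomials $f, g\in K[x]$ are called equivalent, $f\sim g$, if in a splitting field $L$ of $fg$ over $K$, for every root $\alpha\in L$ of $f$ there is a root $\beta\in L$ of $g$ with $K(\alpha)=K(\beta)$, and for every root $\beta \in L$ of $g$ there is a root $\alpha \in L$ of $f$ with $K(\alpha)=K(\beta)$. Write $[f]$ for the equivalence class of $f$. The generalized type of $X$ is the formal product $\prod_{f\in\Phi_X}[f]^{\lambda_f}$, in which the order of the factors is unimportant;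 that is, it is the multiset of pairs $([f],\lambda_f)$, $f\in\Phi_X$. **Theorem.** Let $K$ be a field and let $X, Y\in\mathrm{Mat}_d(K)$. Then $X$ and $Y$ have the same generalized type if and only if there exist polynomials $p,q\in K[x]$ such that $p(X)$ is similar to $Y$ and $q(Y)$ is similar to $X$. -/

import Mathlib

open Polynomial IntermediateField

namespace GenType

section Equivalence

variable {K : Type*} [Field K]

/-- The set `Φ` of irreducible polynomials over `K`, normalised to be monic (so that each irreducible
factor of a characteristic polynomial is represented exactly once). -/
abbrev Irr (K : Type*) [Field K] : Type _ := {f : K[X] // f.Monic ∧ Irreducible f}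

/-- Every root `α ∈ L` of `f` has a root `β ∈ L` of `g` with `K(α) = K(β)`. -/
def RootsMatch (L : Type*) [Field L] [Algebra K L] (f g : K[X]) : Prop :=
  ∀ α : L, aeval α f = 0 → ∃ β : L, aeval β g = 0 ∧ K⟮α⟯ = K⟮β⟯

/-- Equivalence `f ∼ g` of irreducible polynomials, over a splitting field `L` of `f g`. -/
def Equivalent (f g : Irr K) : Prop :=
  RootsMatch (f.1 * g.1).SplittingField f.1 g.1 ∧ RootsMatch (f.1 * g.1).SplittingField g.1 f.1

theorem rootsMatch_iff_of_splits {L M : Type*} [Field L] [Algebra K L] [Field M] [Algebra K M]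
    (φ : L →ₐ[K] M) {f g : K[X]} (hf0 : f ≠ 0) (hg0 : g ≠ 0)
    (hf : (f.map (algebraMap K L)).Splits) (hg : (g.map (algebraMap K L)).Splits) :
    RootsMatch L f g ↔ RootsMatch M f g := by
  have adj : ∀ a : L, K⟮φ a⟯ = (K⟮a⟯).map φ := fun a => by
    rw [IntermediateField.adjoin_map, Set.image_singleton]
  have lift : ∀ h : K[X], h ≠ 0 → (h.map (algebraMap K L)).Splits →
      ∀ b : M, aeval b h = 0 → ∃ a : L, aeval a h = 0 ∧ φ a = b := by
    intro h h0 hs b hb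
    have hb' : b ∈ h.rootSet M := (mem_rootSet_of_ne h0).2 hb
    rw [← hs.image_rootSet φ] at hb'
    obtain ⟨a, ha, rfl⟩ := hb'
    exact ⟨a, (mem_rootSet_of_ne h0).1 ha, rfl⟩
  constructor
  · intro H b hb
    obtain ⟨a, ha, rfl⟩ := lift f hf0 hf b hb
    obtain ⟨c, hc, hac⟩ := H a ha
    exact ⟨φ c, by rw [aeval_algHom_apply, hc, map_zero], by rw [adj, adj, hac]⟩
  · intro H a ha
    obtain ⟨c, hc, hac⟩ := H (φ a) (by rw [aeval_algHom_apply, ha, map_zero])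
    obtain ⟨b, hb, rfl⟩ := lift g hg0 hg c hc
    rw [adj, adj] at hac
    exact ⟨b, hb, IntermediateField.map_injective φ hac⟩

theorem equivalent_iff (f g : Irr K) :
    Equivalent f g ↔
      RootsMatch (AlgebraicClosure K) f.1 g.1 ∧ RootsMatch (AlgebraicClosure K) g.1 f.1 := by
  have hf0 := f.2.2.ne_zero
  have hg0 := g.2.2.ne_zero
  have hs := SplittingField.splits (f.1 * g.1)
  have hi := (algebraMap K (f.1 * g.1).SplittingField).injective
  rw [Polynomial.map_mul, splits_mul
    ((Polynomial.map_ne_zero_iff hi).2 hf0) ((Polynomial.map_ne_zero_iff hi).2 hg0)] at hs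
  have φ : (f.1 * g.1).SplittingField →ₐ[K] AlgebraicClosure K :=
    SplittingField.lift _ (IsAlgClosed.splits _)
  exact and_congr (rootsMatch_iff_of_splits φ hf0 hg0 hs.1 hs.2)
    (rootsMatch_iff_of_splits φ hg0 hf0 hs.2 hs.1)

theorem RootsMatch.trans {L : Type*} [Field L] [Algebra K L] {f g h : K[X]}
    (h₁ : RootsMatch L f g) (h₂ : RootsMatch L g h) : RootsMatch L f h := fun a ha => by
  obtain ⟨b, hb, hab⟩ := h₁ a ha
  obtain ⟨c, hc, hbc⟩ := h₂ b hb
  exact ⟨c, hc, hab.trans hbc⟩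

variable (K) in
/-- The equivalence relation `∼` on `Φ`. -/
def irrSetoid : Setoid (Irr K) where
  r := Equivalent
  iseqv :=
    { refl := fun _ => ⟨fun α hα => ⟨α, hα, rfl⟩, fun α hα => ⟨α, hα, rfl⟩⟩
      symm := fun h => (equivalent_iff _ _).2 ((equivalent_iff _ _).1 h).symm
      trans := fun h₁ h₂ => by
        rw [equivalent_iff] at *
        exact ⟨h₁.1.trans h₂.1, h₂.2.trans h₁.2⟩ }

variable (K) in
/-- The set of equivalence classes `[f]`. -/
abbrev IrrClass : Type _ := Quotient (irrSetoid K)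

end Equivalence

section Decomposition

variable {K V : Type*} [Field K] [AddCommGroup V] [Module K V]

/-- The `T`-invariant subspace `U` is nonzero and is not a direct sum of two nonzero
`T`-invariant subspaces. -/
def IsIndecomposable (T : Module.End K V) (U : T.invtSubmodule) : Prop :=
  U.1 ≠ ⊥ ∧ ∀ A B : T.invtSubmodule, Disjoint A.1 B.1 → A.1 ⊔ B.1 = U.1 → A.1 = ⊥ ∨ B.1 = ⊥

/-- The restriction of `T` to a `T`-invariant subspace. -/
def restr (T : Module.End K V) (U : T.invtSubmodule) : Module.End K U.1 :=
  LinearMap.restrict T ((Module.End.mem_invtSubmodule_iff_forall_mem_of_mem T).1 U.2)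

open Classical in
/-- A decomposition of `V` as the (internal) direct sum of finitely many `T`-invariant subspaces on
each of which the action of `T` is indecomposable. The summands are nonzero and independent, hence
distinct, so they form a finite set. -/
structure IndecDecomposition (T : Module.End K V) where
  parts : Finset T.invtSubmodule
  indec : ∀ U ∈ parts, IsIndecomposable T U
  isInternal : DirectSum.IsInternal (fun U : parts => U.1.1)

theorem exists_parts [FiniteDimensional K V] (T : Module.End K V) (n : ℕ) :
    ∀ W : T.invtSubmodule, Module.finrank K W.1 = n →
      ∃ s : Finset T.invtSubmodule, (∀ U ∈ s, IsIndecomposable T U) ∧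
        s.SupIndep (fun U => U.1) ∧ s.sup (fun U => U.1) = W.1 := by
  classical
  induction n using Nat.strong_induction_on with
  | _ n ih =>
    intro W hW
    by_cases h0 : W.1 = ⊥
    · exact ⟨∅, by simp, by simp, by simp [h0]⟩
    by_cases hi : IsIndecomposable T W
    · exact ⟨{W}, by simpa using hi, by simp, by simp⟩
    have : ∃ A B : T.invtSubmodule,
        Disjoint A.1 B.1 ∧ A.1 ⊔ B.1 = W.1 ∧ A.1 ≠ ⊥ ∧ B.1 ≠ ⊥ := by
      by_contra hc
      refine hi ⟨h0, fun A B hd hs => ?_⟩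
      by_contra hn
      rw [not_or] at hn
      exact hc ⟨A, B, hd, hs, hn.1, hn.2⟩
    obtain ⟨A, B, hd, hs, hA, hB⟩ := this
    have hAW : A.1 < W.1 := lt_of_le_of_ne (hs ▸ le_sup_left) fun h => by
      refine hB (hd.symm.eq_bot_of_le ?_)
      rw [h, ← hs]
      exact le_sup_right
    have hBW : B.1 < W.1 := lt_of_le_of_ne (hs ▸ le_sup_right) fun h => by
      refine hA (hd.eq_bot_of_le ?_)
      rw [h, ← hs]
      exact le_sup_left
    obtain ⟨s, hs1, hs2, hs3⟩ := ih _ (hW ▸ Submodule.finrank_lt_finrank_of_lt hAW) A rfl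
    obtain ⟨t, ht1, ht2, ht3⟩ := ih _ (hW ▸ Submodule.finrank_lt_finrank_of_lt hBW) B rfl
    refine ⟨s ∪ t, ?_, hs2.union ht2 (by rwa [hs3, ht3]), by rw [Finset.sup_union, hs3, ht3, hs]⟩
    intro U hU
    rcases Finset.mem_union.1 hU with h | h
    · exact hs1 U h
    · exact ht1 U h

theorem nonempty_indecDecomposition [FiniteDimensional K V] (T : Module.End K V) :
    Nonempty (IndecDecomposition T) := by
  classical
  obtain ⟨s, h1, h2, h3⟩ := exists_parts T _ ⟨⊤, Module.End.invtSubmodule.top_mem T⟩ rfl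
  refine ⟨⟨s, h1, ?_⟩⟩
  have h4 : DirectSum.IsInternal (fun U : s => U.1.1) := by
    apply DirectSum.isInternal_submodule_of_iSupIndep_of_iSup_eq_top
    · exact iSupIndep_comp_coe_iff_supIndep.2 h2
    · rw [iSup_subtype, ← Finset.sup_eq_iSup]
      exact h3
  convert h4

namespace IndecDecomposition

variable {T : Module.End K V}

open Classical in
/-- The partition `λ_f`: the multiset of the positive integers `t` such that the minimum polynomial
of `T` on a summand is `f ^ t`, one for each such summand. -/
noncomputable def partition (D : IndecDecomposition T) (f : Irr K) : Multiset ℕ :=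
  (D.parts.filter fun U => ∃ t : ℕ, 0 < t ∧ minpoly K (restr T U) = f.1 ^ t).val.map
    fun U => multiplicity f.1 (minpoly K (restr T U))

/-- The set `Φ_T` of irreducible polynomials whose partition is non-empty. -/
def support (D : IndecDecomposition T) : Set (Irr K) := {f | D.partition f ≠ 0}

theorem finite_support (D : IndecDecomposition T) : D.support.Finite := by
  classical
  have hfin : (⋃ U ∈ D.parts,
      {f : Irr K | ∃ t : ℕ, 0 < t ∧ minpoly K (restr T U) = f.1 ^ t}).Finite := by
    refine Set.Finite.biUnion D.parts.finite_toSet fun U _ => Set.Subsingleton.finite ?_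
    rintro f ⟨t, ht, hf⟩ g ⟨u, _, hg⟩
    have hdvd : f.1 ∣ g.1 ^ u := by
      rw [← hg, hf]
      exact dvd_pow_self _ ht.ne'
    have hfg : f.1 ∣ g.1 := f.2.2.prime.dvd_of_dvd_pow hdvd
    exact Subtype.ext (eq_of_monic_of_associated f.2.1 g.2.1 (f.2.2.associated_of_dvd g.2.2 hfg))
  refine hfin.subset fun f hf => ?_
  obtain ⟨x, hx⟩ := Multiset.exists_mem_of_ne_zero hf
  obtain ⟨U, hU, -⟩ := Multiset.mem_map.1 hx
  obtain ⟨h1, h2⟩ := Finset.mem_filter.1 hU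
  exact Set.mem_biUnion h1 h2

/-- The formal product of the `[f] ^ λ_f` over `f ∈ Φ_T`, as a multiset of pairs `([f], λ_f)`. -/
noncomputable def generalizedType (D : IndecDecomposition T) :
    Multiset (IrrClass K × Multiset ℕ) :=
  D.finite_support.toFinset.val.map fun f => (Quotient.mk (irrSetoid K) f, D.partition f)

end IndecDecomposition

end Decomposition

/-- A decomposition of `K ^ d` into indecomposable `X`-invariant subspaces; matrices act on row
vectors from the right. -/
noncomputable def decomposition {K : Type*} [Field K] {d : ℕ} (X : Matrix (Fin d) (Fin d) K) :
    IndecDecomposition (V := Fin d → K) X.vecMulLinear :=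
  Classical.choice (nonempty_indecDecomposition _)

/-- The generalized type of a square matrix. The partitions `λ_f` do not depend on the
decomposition used to compute them. -/
noncomputable def generalizedType {K : Type*} [Field K] {d : ℕ}
    (X : Matrix (Fin d) (Fin d) K) : Multiset (IrrClass K × Multiset ℕ) :=
  (decomposition X).generalizedType

end GenType

/-! Both conditions amount to this: `S` is conjugate to some `p(T)` that has a polynomial inverse,
`T = s(p(T))`. Then `T` and `p(T)` have the same invariant subspaces, so one decomposition serves
both. On a summand where `T` has minimum polynomial `f ^ t`, that of `p(T)` is `g ^ t`, where `g` is
the minimum polynomial of `p(α)` for a root `α` of `f`. Since `s` undoes `p`, `K(p(α)) = K(α)`, so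
`f ∼ g`; this is `generalizedType_transfer`.

If `p(T)` is conjugate to `S` and `q(S)` to `T`, the ends of the chain `K[q(p(T))] ⊆ K[p(T)] ⊆ K[T]`
are conjugate, hence of equal dimension, and `s` exists (`exists_eq_aeval_of_conj`). The ranks of
the `f(T) ^ k` determine the partitions, so these depend neither on the decomposition nor on the
choice within a similarity class.

Conversely, let equal types match each `f` with an equivalent `g`. From `K(α) = K(β)` come `p`, `q`
with `p(α) = β`, `q(β) = α`, but these are inverse only modulo `f`, and non-semisimple summands need
powers of `f`. A Hensel-type lift (`exists_comp_inverse_mod_pow`) works once `f` divides `g.comp p`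
exactly once, which `exists_exact_dvd_comp` arranges, treating inseparable `f` separately. The
Chinese remainder theorem combines all `f`. The resulting `p(T)` has the partitions of `S`, and
partitions determine similarity because every summand is `K[X] / (f ^ t)`. -/

namespace GenType

/-! ### Inverting a substitution modulo powers of irreducibles -/

section PolynomialLemmas

variable {K : Type*} [Field K]

/-- Taylor expansion of a composition to first order. -/
theorem exists_comp_add_eq (g p r : K[X]) :
    ∃ k : K[X], g.comp (p + r) = g.comp p + g.derivative.comp p * r + k * r ^ 2 := by
  -- With coefficients mapped into `K[X]`, composition becomes evaluation at an element of that
  -- ring.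
  obtain ⟨k, hk⟩ := (g.map C).binomExpansion p r
  refine ⟨k, ?_⟩
  simpa [derivative_map, eval_map, comp] using hk

theorem sub_dvd_comp_sub_comp (s p q : K[X]) : p - q ∣ s.comp p - s.comp q := by
  simpa [comp, eval_map] using sub_dvd_eval_sub p q (s.map C)

theorem comp_dvd_comp {p q : K[X]} (h : p ∣ q) (r : K[X]) : p.comp r ∣ q.comp r := by
  obtain ⟨c, rfl⟩ := h
  exact ⟨c.comp r, mul_comp _ _ _⟩

theorem dvd_comp_of_dvd_sub {f s p q : K[X]} (h : f ∣ p - q) (hs : f ∣ s.comp q) :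
    f ∣ s.comp p := by
  have := dvd_add (h.trans (sub_dvd_comp_sub_comp s p q)) hs
  rwa [sub_add_cancel] at this

theorem not_dvd_derivative {f : K[X]} (hf : f.derivative ≠ 0) : ¬ f ∣ f.derivative := fun h =>
  not_lt_of_ge (degree_le_of_dvd h hf) (degree_derivative_lt (by rintro rfl; simp at hf))

/-- A polynomial taking a root of `f` to a root of `g` that generates the same field can be
adjusted so that `f` divides `g.comp p` exactly once. -/
theorem exists_exact_dvd_comp {f g p q : K[X]} (hf : Irreducible f)
    (hsep : f.derivative = 0 ∨ g.derivative ≠ 0) (hg : f ∣ g.comp p) (hfq : g ∣ f.comp q)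
    (hqp : f ∣ q.comp p - X) (hpq : g ∣ p.comp q - X) :
    ∃ p' : K[X], f ∣ p' - p ∧ f ∣ g.comp p' ∧ ¬ f ^ 2 ∣ g.comp p' := by
  by_cases h2 : f ^ 2 ∣ g.comp p
  · rcases hsep with h0 | h0
    -- When `f' = 0`, expanding `f` at `q.comp p = X + f * s` has no linear term, so `f(q(p)) ≡ f`
    -- modulo `f ^ 2`; but `f ^ 2` divides `g.comp p`, which divides `f(q(p))`.
    · exfalso
      obtain ⟨s, hs⟩ := hqp
      obtain ⟨k, hk⟩ := exists_comp_add_eq f X (f * s)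
      have h1 : f ^ 2 ∣ (f.comp q).comp p := h2.trans (comp_dvd_comp hfq p)
      rw [comp_assoc, ← sub_add_cancel (q.comp p) X, hs, add_comm, hk, h0] at h1
      simp only [comp_X, zero_mul, add_zero] at h1
      have h3 : f ^ 2 ∣ f := by
        have : f ^ 2 ∣ k * (f * s) ^ 2 := ⟨k * s ^ 2, by ring⟩
        exact (dvd_add_left this).1 h1
      rw [sq] at h3
      have h4 : f * f ∣ f * 1 := by rwa [mul_one]
      exact hf.not_isUnit (isUnit_of_dvd_one ((mul_dvd_mul_iff_left hf.ne_zero).1 h4))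
    -- Replacing `p` by `p + f` adds `g'(p) * f` modulo `f ^ 2`. If `f` divided `g'(p)`, composing
    -- with `q` would give `g ∣ g'`.
    · obtain ⟨k, hk⟩ := exists_comp_add_eq g p f
      refine ⟨p + f, by simp, dvd_comp_of_dvd_sub (by simp) hg, fun h => ?_⟩
      rw [hk] at h
      have h3 : f ^ 2 ∣ g.derivative.comp p * f :=
        (dvd_add_right h2).1 ((dvd_add_left (dvd_mul_left _ _)).1 h)
      rw [sq, mul_dvd_mul_iff_right hf.ne_zero] at h3
      have h4 : g ∣ (g.derivative.comp p).comp q := hfq.trans (comp_dvd_comp h3 q)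
      rw [comp_assoc] at h4
      have h5 : g ∣ g.derivative.comp X :=
        dvd_comp_of_dvd_sub (by rw [dvd_sub_comm]; exact hpq) h4
      rw [comp_X] at h5
      exact not_dvd_derivative h0 h5
  · exact ⟨p, by simp, hg, h2⟩

/-- A left inverse modulo `f` with respect to composition lifts to one modulo `f ^ N`. -/
theorem exists_comp_inverse_mod_pow {f g p q : K[X]} (hf : Irreducible f) (hg : f ∣ g.comp p)
    (hg2 : ¬ f ^ 2 ∣ g.comp p) (hqp : f ∣ q.comp p - X) (N : ℕ) :
    ∃ s : K[X], f ^ N ∣ s.comp p - X := by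
  obtain ⟨u, hu⟩ := hg
  have hfu : ¬ f ∣ u := fun h => hg2 (by rw [hu, sq]; exact mul_dvd_mul_left _ h)
  induction N with
  | zero => exact ⟨0, by simp⟩
  | succ N ih =>
    rcases Nat.eq_zero_or_pos N with rfl | hN
    · exact ⟨q, by simpa using hqp⟩
    obtain ⟨s, h, hs⟩ := ih
    obtain ⟨a, v, hav⟩ : IsCoprime f (u ^ N) :=
      ((hf.coprime_iff_not_dvd).2 hfu).pow_right
    -- Newton-style correction: here `g.comp p = f * u` and `v` inverts `u ^ N` modulo `f`, so after
    -- composing with `p` the added term cancels the error `f ^ N * h` modulo `f ^ (N + 1)`.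
    refine ⟨s - g ^ N * (h * v).comp q, ?_⟩
    have h1 : (s - g ^ N * (h * v).comp q).comp p - X =
        f ^ N * (h - u ^ N * (h * v).comp (q.comp p)) := by
      rw [sub_comp, mul_comp, pow_comp, hu, comp_assoc, sub_right_comm, hs]
      ring
    rw [h1, pow_succ]
    refine mul_dvd_mul_left _ ?_
    have h2 : f ∣ (h * v).comp (q.comp p) - h * v := by
      have := hqp.trans (sub_dvd_comp_sub_comp (h * v) (q.comp p) X)
      rwa [comp_X] at this
    have h3 : h - u ^ N * (h * v).comp (q.comp p) =
        f * (a * h) - u ^ N * ((h * v).comp (q.comp p) - h * v) := by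
      linear_combination -h * hav
    rw [h3]
    exact dvd_sub (dvd_mul_right _ _) (h2.mul_left _)

theorem exists_aeval_eq_of_mem_adjoin {L : Type*} [Field L] [Algebra K L] {α β : L}
    (hα : IsIntegral K α) (h : β ∈ K⟮α⟯) : ∃ p : K[X], aeval α p = β := by
  rw [← mem_toSubalgebra, adjoin_simple_toSubalgebra_of_isAlgebraic hα.isAlgebraic,
    Algebra.adjoin_singleton_eq_range_aeval] at h
  exact h

theorem Irr.minpoly_eq (f : Irr K) {L : Type*} [Ring L] [IsDomain L] [Algebra K L] {α : L}
    (hα : aeval α f.1 = 0) : minpoly K α = f.1 :=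
  (minpoly.eq_of_irreducible_of_monic f.2.2 hα f.2.1).symm

theorem Irr.dvd_iff (f : Irr K) {L : Type*} [Ring L] [IsDomain L] [Algebra K L] {α : L}
    (hα : aeval α f.1 = 0) {h : K[X]} : f.1 ∣ h ↔ aeval α h = 0 := by
  rw [← f.minpoly_eq hα, minpoly.dvd_iff]

theorem Irr.isIntegral (f : Irr K) {L : Type*} [Ring L] [Algebra K L] {α : L}
    (hα : aeval α f.1 = 0) : IsIntegral K α := ⟨f.1, f.2.1, by rwa [← aeval_def]⟩

theorem Irr.exists_root (f : Irr K) : ∃ α : AlgebraicClosure K, aeval α f.1 = 0 :=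
  IsAlgClosed.exists_aeval_eq_zero _ f.1 (degree_pos_of_irreducible f.2.2).ne'

/-- Equivalent irreducible polynomials are related by substitutions that are mutually inverse
modulo arbitrarily high powers. -/
theorem Equivalent.exists_comp_inverse {f g : Irr K} (h : Equivalent f g) (N : ℕ) :
    ∃ p s : K[X], f.1 ∣ g.1.comp p ∧ f.1 ^ N ∣ s.comp p - X := by
  obtain ⟨α, hα⟩ := f.exists_root
  obtain ⟨β, hβ, hαβ⟩ := ((equivalent_iff f g).1 h).1 α hα
  obtain ⟨p, hp⟩ := exists_aeval_eq_of_mem_adjoin (f.isIntegral hα)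
    (hαβ ▸ mem_adjoin_simple_self K β)
  obtain ⟨q, hq⟩ := exists_aeval_eq_of_mem_adjoin (g.isIntegral hβ)
    (hαβ ▸ mem_adjoin_simple_self K α)
  have hg : f.1 ∣ g.1.comp p := by rw [f.dvd_iff hα, aeval_comp, hp, hβ]
  have hfq : g.1 ∣ f.1.comp q := by rw [g.dvd_iff hβ, aeval_comp, hq, hα]
  have hqp : f.1 ∣ q.comp p - X := by
    rw [f.dvd_iff hα, map_sub, aeval_comp, hp, hq, aeval_X, sub_self]
  have hpq : g.1 ∣ p.comp q - X := by
    rw [g.dvd_iff hβ, map_sub, aeval_comp, hq, hp, aeval_X, sub_self]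
  -- `K(α) = K(β)` is separable for both generators or for neither.
  have hsep : f.1.derivative = 0 ∨ g.1.derivative ≠ 0 := by
    by_contra hc
    rw [not_or, not_not] at hc
    have h1 : IsSeparable K α := by
      rw [IsSeparable, f.minpoly_eq hα]
      exact (separable_iff_derivative_ne_zero f.2.2).2 hc.1
    have h2 : IsSeparable K β := by
      rw [← isSeparable_adjoin_simple_iff_isSeparable] at h1 ⊢
      rwa [← hαβ]
    rw [IsSeparable, g.minpoly_eq hβ] at h2
    exact (separable_iff_derivative_ne_zero g.2.2).1 h2 hc.2
  obtain ⟨p', h1, h2, h3⟩ := exists_exact_dvd_comp f.2.2 hsep hg hfq hqp hpq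
  have hqp' : f.1 ∣ q.comp p' - X := by
    have := dvd_add (h1.trans (sub_dvd_comp_sub_comp q p' p)) hqp
    rwa [sub_add_sub_cancel] at this
  obtain ⟨s, hs⟩ := exists_comp_inverse_mod_pow f.2.2 h2 h3 hqp' N
  exact ⟨p', s, h2, hs⟩

theorem Irr.eq_of_dvd {f g : Irr K} (h : f.1 ∣ g.1) : f = g :=
  Subtype.ext (eq_of_monic_of_associated f.2.1 g.2.1 (f.2.2.associated_of_dvd g.2.2 h))

theorem Irr.isCoprime {f g : Irr K} (h : f ≠ g) : IsCoprime f.1 g.1 :=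
  (f.2.2.coprime_iff_not_dvd).2 fun hd => h (Irr.eq_of_dvd hd)

theorem Irr.exists_forall_dvd_sub {ι : Type*} [Finite ι] (f : ι → Irr K)
    (hf : Function.Injective f) (N : ℕ) (r : ι → K[X]) : ∃ p : K[X], ∀ i, (f i).1 ^ N ∣ p - r i := by
  obtain ⟨p, hp⟩ := Ideal.exists_forall_sub_mem_ideal
    (I := fun i => Ideal.span {(f i).1 ^ N}) (fun i j hij => by
      exact (Ideal.isCoprime_span_singleton_iff _ _).2 (Irr.isCoprime (hf.ne hij)).pow) r
  exact ⟨p, fun i => Ideal.mem_span_singleton.1 (hp i)⟩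

/-- Simultaneous version of `Equivalent.exists_comp_inverse`. -/
theorem exists_simultaneous_comp_inverse {ι : Type*} [Finite ι] (f g : ι → Irr K)
    (hf : Function.Injective f) (hg : Function.Injective g) (h : ∀ i, Equivalent (f i) (g i))
    (N : ℕ) :
    ∃ p s : K[X], ∀ i, (f i).1 ∣ (g i).1.comp p ∧ (f i).1 ^ N ∣ s.comp p - X := by
  -- The exponent `N + 1` is positive, so the congruences below hold modulo `f i` itself even when
  -- `N = 0`.
  choose p₀ s₀ h1 h2 using fun i => (h i).exists_comp_inverse (N + 1)
  obtain ⟨p, hp⟩ := Irr.exists_forall_dvd_sub f hf (N + 1) p₀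
  obtain ⟨s, hs⟩ := Irr.exists_forall_dvd_sub g hg (N + 1) s₀
  refine ⟨p, s, fun i => ?_⟩
  have h3 : (f i).1 ∣ (g i).1.comp p :=
    dvd_comp_of_dvd_sub ((dvd_pow_self _ N.succ_ne_zero).trans (hp i)) (h1 i)
  refine ⟨h3, (pow_dvd_pow _ N.le_succ).trans ?_⟩
  have h4 : (f i).1 ^ (N + 1) ∣ (s - s₀ i).comp p := by
    refine dvd_trans ?_ (comp_dvd_comp (hs i) p)
    rw [pow_comp]
    exact pow_dvd_pow_of_dvd h3 _
  have h5 : s.comp p - X = (s - s₀ i).comp p + ((s₀ i).comp p - (s₀ i).comp (p₀ i))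
      + ((s₀ i).comp (p₀ i) - X) := by
    rw [sub_comp]; ring
  rw [h5]
  exact dvd_add (dvd_add h4 ((hp i).trans (sub_dvd_comp_sub_comp _ _ _))) (h2 i)

end PolynomialLemmas

/-! ### Indecomposable summands are cyclic primary modules -/

section Cyclic

variable {K V : Type*} [Field K] [AddCommGroup V] [Module K V]

/-- The endomorphism `T` makes `V` into a `K[X]`-module isomorphic to `K[X] / (m)`. -/
def IsCyclicWith (T : Module.End K V) (m : K[X]) : Prop :=
  ∃ φ : (K[X] ⧸ Ideal.span {m}) ≃ₗ[K] V, ∀ (q : K[X]) (a : K[X] ⧸ Ideal.span {m}),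
    φ (q • a) = aeval T q (φ a)

theorem IsCyclicWith.aeval_eq_zero_iff {T : Module.End K V} {m : K[X]} (h : IsCyclicWith T m)
    (q : K[X]) : aeval T q = 0 ↔ m ∣ q := by
  obtain ⟨φ, hφ⟩ := h
  constructor
  · intro hq
    have h1 := hφ q (Ideal.Quotient.mk _ 1)
    rw [hq, LinearMap.zero_apply, LinearEquiv.map_eq_zero_iff] at h1
    have h2 : Ideal.Quotient.mk (Ideal.span {m}) (q • 1) = 0 := h1
    rwa [Ideal.Quotient.eq_zero_iff_dvd, smul_eq_mul, mul_one] at h2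
  · intro hq
    ext v
    obtain ⟨a, rfl⟩ := φ.surjective v
    obtain ⟨a, rfl⟩ := Ideal.Quotient.mk_surjective a
    rw [← hφ, LinearMap.zero_apply, LinearEquiv.map_eq_zero_iff]
    change Ideal.Quotient.mk (Ideal.span {m}) (q • a) = 0
    rw [Ideal.Quotient.eq_zero_iff_dvd, smul_eq_mul]
    exact hq.mul_right _

theorem IsCyclicWith.minpoly_eq {T : Module.End K V} {m : K[X]} (h : IsCyclicWith T m)
    (hm : m.Monic) : minpoly K T = m := by
  have hint : IsIntegral K T :=
    ⟨m, hm, by rw [← aeval_def]; exact (h.aeval_eq_zero_iff m).2 dvd_rfl⟩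
  refine eq_of_monic_of_associated (minpoly.monic hint) hm (associated_of_dvd_dvd ?_ ?_)
  · exact minpoly.dvd _ _ ((h.aeval_eq_zero_iff m).2 dvd_rfl)
  · exact (h.aeval_eq_zero_iff _).1 (minpoly.aeval _ _)

theorem IsCyclicWith.exists_equiv {V' : Type*} [AddCommGroup V'] [Module K V']
    {T : Module.End K V} {T' : Module.End K V'} {m : K[X]} (h : IsCyclicWith T m)
    (h' : IsCyclicWith T' m) : ∃ e : V ≃ₗ[K] V', ∀ v, e (T v) = T' (e v) := by
  obtain ⟨φ, hφ⟩ := h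
  obtain ⟨ψ, hψ⟩ := h'
  refine ⟨φ.symm.trans ψ, fun v => ?_⟩
  obtain ⟨a, rfl⟩ := φ.surjective v
  have h1 := hφ X a
  have h2 := hψ X a
  rw [aeval_X] at h1 h2
  rw [← h1]
  simpa using h2

/-- The rank of `f(T)` when `T` is cyclic. -/
theorem IsCyclicWith.finrank_range {T : Module.End K V} {m f n : K[X]} (h : IsCyclicWith T m)
    (hn : ∀ q, m ∣ f * q ↔ n ∣ q) :
    Module.finrank K (LinearMap.range (aeval T f)) = n.natDegree := by
  obtain ⟨φ, hφ⟩ := h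
  -- `ρ` sends `q` to the image of `f * q`; its range is that of `f(T)`, and `hn` says that its
  -- kernel is the ideal generated by `n`.
  let ρ : K[X] →ₗ[K] V :=
    (aeval T f) ∘ₗ φ.toLinearMap ∘ₗ (Ideal.Quotient.mkₐ K (Ideal.span {m})).toLinearMap
  have hρ : LinearMap.range ρ = LinearMap.range (aeval T f) := by
    rw [LinearMap.range_comp_of_range_eq_top]
    rw [LinearMap.range_eq_top]
    exact φ.surjective.comp (Ideal.Quotient.mkₐ_surjective K _)
  have hk : LinearMap.ker ρ = (Ideal.span {n}).restrictScalars K := by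
    ext q
    have h1 : ρ q = φ (Ideal.Quotient.mk (Ideal.span {m}) (f * q)) := (hφ f _).symm
    rw [LinearMap.mem_ker, h1, LinearEquiv.map_eq_zero_iff, Ideal.Quotient.eq_zero_iff_dvd, hn,
      Submodule.restrictScalars_mem, Ideal.mem_span_singleton]
  rw [← hρ, ← (ρ.quotKerEquivRange).finrank_eq, hk, ← finrank_quotient_span_eq_natDegree]
  rfl

/-- By the structure theorem for torsion modules over `K[X]`, `V` is a direct sum of primary cyclic
modules. A nonzero one splits off, and indecomposability kills its complement. -/
theorem isCyclicWith_of_indecomposable [FiniteDimensional K V] [Nontrivial V]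
    (T : Module.End K V)
    (h : ∀ A B : T.invtSubmodule, Disjoint A.1 B.1 → A.1 ⊔ B.1 = ⊤ → A.1 = ⊥ ∨ B.1 = ⊥) :
    ∃ (f : Irr K) (t : ℕ), 0 < t ∧ IsCyclicWith T (f.1 ^ t) := by
  classical
  have hind : ∀ A B : Submodule K[X] (Module.AEval' T), IsCompl A B → A = ⊥ ∨ B = ⊥ := by
    intro A B hAB
    have key : ∀ N : Submodule K[X] (Module.AEval' T),
        ∃ W : T.invtSubmodule, ∀ v, v ∈ W.1 ↔ Module.AEval'.of T v ∈ N := fun N =>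
      ⟨⟨(N.restrictScalars K).comap (Module.AEval'.of T).toLinearMap, fun v hv => by
        have h1 := N.smul_mem X (show Module.AEval'.of T v ∈ N from hv)
        rw [Module.AEval'.X_smul_of] at h1
        exact h1⟩, fun v => Iff.rfl⟩
    obtain ⟨A', hA'⟩ := key A
    obtain ⟨B', hB'⟩ := key B
    have hbot : ∀ (N : Submodule K[X] (Module.AEval' T)) (W : T.invtSubmodule),
        (∀ v, v ∈ W.1 ↔ Module.AEval'.of T v ∈ N) → W.1 = ⊥ → N = ⊥ := by
      intro N W hW h0
      rw [Submodule.eq_bot_iff]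
      intro x hx
      obtain ⟨v, rfl⟩ := (Module.AEval'.of T).surjective x
      have : v ∈ W.1 := (hW v).2 hx
      rw [h0, Submodule.mem_bot] at this
      rw [this, map_zero]
    refine (h A' B' ?_ ?_).imp (hbot A A' hA') (hbot B B' hB')
    · rw [Submodule.disjoint_def]
      intro v hv hv'
      have := (Submodule.disjoint_def.1 hAB.disjoint) _ ((hA' v).1 hv) ((hB' v).1 hv')
      exact (LinearEquiv.map_eq_zero_iff _).1 this
    · rw [eq_top_iff]
      intro v _
      have h1 : Module.AEval'.of T v ∈ A ⊔ B := by rw [hAB.sup_eq_top]; trivial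
      obtain ⟨a, ha, b, hb, hab⟩ := Submodule.mem_sup.1 h1
      obtain ⟨a, rfl⟩ := (Module.AEval'.of T).surjective a
      obtain ⟨b, rfl⟩ := (Module.AEval'.of T).surjective b
      rw [← map_add] at hab
      rw [← (Module.AEval'.of T).injective hab]
      exact Submodule.add_mem_sup ((hA' a).2 ha) ((hB' b).2 hb)
  have htors : Module.IsTorsion K[X] (Module.AEval' T) := by
    intro x
    obtain ⟨v, rfl⟩ := (Module.AEval'.of T).surjective x
    refine ⟨⟨minpoly K T, mem_nonZeroDivisors_of_ne_zero
      (minpoly.ne_zero (Algebra.IsIntegral.isIntegral T))⟩, ?_⟩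
    change minpoly K T • Module.AEval'.of T v = 0
    have := Module.AEval.of_aeval_smul (R := K) T (minpoly K T) v
    rw [minpoly.aeval, zero_smul, map_zero] at this
    exact this.symm
  obtain ⟨ι, _, p, hp, e, ⟨E⟩⟩ := Module.equiv_directSum_of_isTorsion htors
  -- The structure theorem allows exponent `0`, that is, trivial factors; not all are trivial since
  -- `V` is not.
  have hne : ∃ i, e i ≠ 0 := by
    by_contra hc
    push Not at hc
    have hsub : ∀ i, Subsingleton (K[X] ⧸ Submodule.span K[X] {p i ^ e i}) := fun i => by
      rw [hc i, pow_zero]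
      exact Ideal.Quotient.subsingleton_iff.2 Ideal.span_singleton_one
    have h1 : Subsingleton (Module.AEval' T) := E.toEquiv.subsingleton
    exact not_subsingleton V ((Module.AEval'.of T).toEquiv.subsingleton)
  obtain ⟨i, hi⟩ := hne
  let π := (DirectSum.component K[X] ι (fun i => K[X] ⧸ Submodule.span K[X] {p i ^ e i}) i) ∘ₗ
    E.toLinearMap
  let σ := E.symm.toLinearMap ∘ₗ
    (DirectSum.lof K[X] ι (fun i => K[X] ⧸ Submodule.span K[X] {p i ^ e i}) i)
  have hπσ : ∀ a, π (σ a) = a := fun a => by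
    simp [π, σ, DirectSum.component.lof_self]
  have hcompl : IsCompl (LinearMap.range σ) (LinearMap.ker π) := by
    refine ⟨?_, ?_⟩
    · rw [Submodule.disjoint_def]
      rintro _ ⟨a, rfl⟩ ha
      rw [LinearMap.mem_ker, hπσ] at ha
      rw [ha, map_zero]
    · rw [codisjoint_iff, eq_top_iff]
      intro x _
      rw [← add_sub_cancel (σ (π x)) x]
      exact Submodule.add_mem_sup ⟨π x, rfl⟩ (by rw [LinearMap.mem_ker, map_sub, hπσ, sub_self])
  have hnt : Nontrivial (K[X] ⧸ Submodule.span K[X] {p i ^ e i}) := by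
    refine Ideal.Quotient.nontrivial_iff.2 ?_
    change Ideal.span _ ≠ ⊤
    rw [Ne, Ideal.span_singleton_eq_top, isUnit_pow_iff hi]
    exact (hp i).not_isUnit
  have hker : LinearMap.ker π = ⊥ := by
    refine (hind _ _ hcompl).resolve_left fun h0 => ?_
    obtain ⟨a, ha⟩ := exists_ne (0 : K[X] ⧸ Submodule.span K[X] {p i ^ e i})
    have h1 : σ a = 0 := by
      have : σ a ∈ LinearMap.range σ := ⟨a, rfl⟩
      rwa [h0, Submodule.mem_bot] at this
    exact ha (by rw [← hπσ a, h1, map_zero])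
  let F : Module.AEval' T ≃ₗ[K[X]] (K[X] ⧸ Submodule.span K[X] {p i ^ e i}) :=
    LinearEquiv.ofBijective π ⟨LinearMap.ker_eq_bot.1 hker, fun a => ⟨σ a, hπσ a⟩⟩
  -- The primes supplied by the structure theorem need not be monic.
  have hpn : Associated (p i) (p i * C (p i).leadingCoeff⁻¹) :=
    associated_mul_unit_right _ _
      (isUnit_C.2 (IsUnit.mk0 _ (inv_ne_zero (leadingCoeff_ne_zero.2 (hp i).ne_zero))))
  refine ⟨⟨p i * C (p i).leadingCoeff⁻¹, monic_mul_leadingCoeff_inv (hp i).ne_zero,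
    hpn.irreducible (hp i)⟩, e i, Nat.pos_of_ne_zero hi, ?_⟩
  have hspan : Ideal.span {(p i * C (p i).leadingCoeff⁻¹) ^ e i} =
      Submodule.span K[X] {p i ^ e i} :=
    Ideal.span_singleton_eq_span_singleton.2 hpn.pow_pow.symm
  let G : (K[X] ⧸ Ideal.span {(p i * C (p i).leadingCoeff⁻¹) ^ e i}) ≃ₗ[K[X]] Module.AEval' T :=
    (Submodule.quotEquivOfEq _ _ hspan).trans F.symm
  refine ⟨(G.restrictScalars K).trans (Module.AEval'.of T).symm, fun q a => ?_⟩
  change (Module.AEval'.of T).symm (G (q • a)) = _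
  rw [map_smul]
  exact Module.AEval.of_symm_smul _ _ _

theorem IsIndecomposable.isCyclicWith [FiniteDimensional K V] {T : Module.End K V}
    {U : T.invtSubmodule} (h : IsIndecomposable T U) :
    ∃ (f : Irr K) (t : ℕ), 0 < t ∧ IsCyclicWith (restr T U) (f.1 ^ t) := by
  have : Nontrivial U.1 := Submodule.nontrivial_iff_ne_bot.2 h.1
  refine isCyclicWith_of_indecomposable (restr T U) fun A B hd hs => ?_
  have hinv : ∀ A : (restr T U).invtSubmodule, A.1.map U.1.subtype ∈ T.invtSubmodule := by
    intro A
    rw [Module.End.mem_invtSubmodule_iff_forall_mem_of_mem]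
    rintro _ ⟨a, ha, rfl⟩
    exact ⟨restr T U a, (Module.End.mem_invtSubmodule_iff_forall_mem_of_mem _).1 A.2 a ha, rfl⟩
  have hbot : ∀ A : Submodule K U.1, A.map U.1.subtype = ⊥ → A = ⊥ := fun A hA =>
    Submodule.map_injective_of_injective U.1.injective_subtype (hA.trans (Submodule.map_bot _).symm)
  refine (h.2 ⟨_, hinv A⟩ ⟨_, hinv B⟩ ?_ ?_).imp (hbot _) (hbot _)
  · exact Submodule.disjoint_map U.1.injective_subtype hd
  · change A.1.map U.1.subtype ⊔ B.1.map U.1.subtype = U.1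
    rw [← Submodule.map_sup, hs, Submodule.map_top, Submodule.range_subtype]

end Cyclic

/-! ### Intertwining maps, restrictions and ranks -/

section Intertwining

variable {K V V' : Type*} [Field K] [AddCommGroup V] [Module K V] [AddCommGroup V'] [Module K V']

theorem aeval_intertwine {T : Module.End K V} {T' : Module.End K V'} (e : V →ₗ[K] V')
    (h : ∀ v, e (T v) = T' (e v)) (q : K[X]) (v : V) : e (aeval T q v) = aeval T' q (e v) := by
  induction q using Polynomial.induction_on generalizing v with
  | C a => simp [Module.algebraMap_end_apply]
  | add p q hp hq => simp [hp, hq]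
  | monomial n a ih =>
    have h1 : ∀ (S : Module.End K V) (w : V),
        aeval S (C a * X ^ (n + 1)) w = aeval S (C a * X ^ n) (S w) := fun S w => by
      rw [pow_succ, ← mul_assoc, map_mul, aeval_X, Module.End.mul_apply]
    have h2 : ∀ (S : Module.End K V') (w : V'),
        aeval S (C a * X ^ (n + 1)) w = aeval S (C a * X ^ n) (S w) := fun S w => by
      rw [pow_succ, ← mul_assoc, map_mul, aeval_X, Module.End.mul_apply]
    rw [h1, h2, ih, h]

theorem finrank_range_aeval_eq {T : Module.End K V} {T' : Module.End K V'} (e : V ≃ₗ[K] V')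
    (h : ∀ v, e (T v) = T' (e v)) (q : K[X]) :
    Module.finrank K (LinearMap.range (aeval T q)) =
      Module.finrank K (LinearMap.range (aeval T' q)) := by
  have h1 : (LinearMap.range (aeval T q)).map e.toLinearMap = LinearMap.range (aeval T' q) := by
    ext w
    constructor
    · rintro ⟨_, ⟨v, rfl⟩, rfl⟩
      exact ⟨e v, (aeval_intertwine e.toLinearMap h q v).symm⟩
    · rintro ⟨w, rfl⟩
      obtain ⟨v, rfl⟩ := e.surjective w
      exact ⟨_, ⟨v, rfl⟩, aeval_intertwine e.toLinearMap h q v⟩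
  rw [← h1]
  exact (LinearEquiv.finrank_map_eq e _).symm

theorem coe_aeval_restr (T : Module.End K V) (U : T.invtSubmodule) (q : K[X]) (u : U.1) :
    (aeval (restr T U) q u : V) = aeval T q u :=
  aeval_intertwine U.1.subtype (fun _ => rfl) q u

theorem finrank_finset_sup {ι : Type*} [FiniteDimensional K V] {s : Finset ι}
    {W : ι → Submodule K V} (h : s.SupIndep W) :
    Module.finrank K (s.sup W : Submodule K V) = ∑ i ∈ s, Module.finrank K (W i) := by
  classical
  induction s using Finset.induction_on with
  | empty => simp
  | insert a s ha ih =>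
    rw [Finset.sup_insert, Finset.sum_insert ha, ← ih (h.subset (Finset.subset_insert a s))]
    have hd : Disjoint (W a) (s.sup W) :=
      h (Finset.subset_insert a s) (Finset.mem_insert_self a s) ha
    rw [← Submodule.finrank_sup_add_finrank_inf_eq, hd.eq_bot, finrank_bot, add_zero]

end Intertwining

/-! ### Multisets recovered from sums and fibres -/

/-- Differencing in `k` removes the constants' influence and leaves the number of entries above `k`;
differencing again gives the multiplicity of `k + 1`. Truncated subtraction cannot see entries equal
to `0`, hence `hs` and `ht`. -/
theorem multiset_eq_of_sum_tsub {s t : Multiset ℕ} (hs : 0 ∉ s) (ht : 0 ∉ t) {n a b : ℕ}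
    (hn : 0 < n)
    (h : ∀ k, (s.map fun x => (x - k) * n).sum + a = (t.map fun x => (x - k) * n).sum + b) :
    s = t := by
  have key : ∀ (s : Multiset ℕ) (k : ℕ), (s.map fun x => (x - k) * n).sum =
      (s.map fun x => (x - (k + 1)) * n).sum + s.countP (k < ·) * n := by
    intro s k
    induction s using Multiset.induction_on with
    | empty => simp
    | cons x s ih =>
      rw [Multiset.map_cons, Multiset.sum_cons, Multiset.map_cons, Multiset.sum_cons, ih,
        Multiset.countP_cons]
      split_ifs with hx
      · obtain ⟨y, rfl⟩ := Nat.exists_eq_add_of_lt hx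
        have h1 : k + y + 1 - k = y + 1 := by omega
        have h2 : k + y + 1 - (k + 1) = y := by omega
        rw [h1, h2]
        ring
      · have h1 : x - k = 0 := by omega
        have h2 : x - (k + 1) = 0 := by omega
        rw [h1, h2]
        ring
  have hcount : ∀ k, s.countP (k < ·) = t.countP (k < ·) := by
    intro k
    have h1 := h k
    have h2 := h (k + 1)
    rw [key s k, key t k] at h1
    exact Nat.eq_of_mul_eq_mul_right hn (by omega)
  have hsplit : ∀ (s : Multiset ℕ) (k : ℕ),
      s.countP (k < ·) = s.count (k + 1) + s.countP (k + 1 < ·) := by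
    intro s k
    induction s using Multiset.induction_on with
    | empty => simp
    | cons x s ih =>
      rw [Multiset.countP_cons, Multiset.countP_cons, Multiset.count_cons, ih]
      split_ifs <;> omega
  ext k
  rcases k with _ | k
  · rw [Multiset.count_eq_zero_of_notMem hs, Multiset.count_eq_zero_of_notMem ht]
  · have h1 := hcount k
    rw [hsplit s k, hsplit t k, hcount (k + 1)] at h1
    omega

theorem card_fiber_eq_count {α γ : Type*} [DecidableEq γ] (s : Finset α) (F : α → γ) (c : γ) :
    Fintype.card {x : s // F x = c} = (s.val.map F).count c := by
  rw [Multiset.count_map, Fintype.card_subtype, ← Finset.filter_val, Finset.card_val]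
  refine Finset.card_bij (fun x _ => x.1) ?_ ?_ ?_
  · intro x hx
    exact Finset.mem_filter.2 ⟨x.2, (Finset.mem_filter.1 hx).2.symm⟩
  · intro x _ y _ h
    exact Subtype.ext h
  · intro x hx
    obtain ⟨h1, h2⟩ := Finset.mem_filter.1 hx
    exact ⟨⟨x, h1⟩, Finset.mem_filter.2 ⟨Finset.mem_univ _, h2.symm⟩, rfl⟩

/-- Multiplicities are fibre sizes, so corresponding fibres biject and the bijections glue. -/
theorem exists_equiv_of_multiset_map_eq {α β γ : Type*} {s : Finset α} {t : Finset β} {F : α → γ}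
    {G : β → γ} (h : s.val.map F = t.val.map G) : ∃ σ : s ≃ t, ∀ x, G (σ x) = F x := by
  classical
  have hE : ∀ c, Nonempty ({x : s // F x = c} ≃ {x : t // G x = c}) := fun c =>
    Fintype.card_eq.1 (by rw [card_fiber_eq_count s F c, card_fiber_eq_count t G c, h])
  exact ⟨Equiv.ofFiberEquiv (f := fun x : s => F x) (g := fun x : t => G x) fun c => (hE c).some,
    fun x => Equiv.ofFiberEquiv_map (f := fun x : s => F x) (g := fun x : t => G x) _ x⟩

/-! ### Partitions as complete similarity invariants -/

namespace IndecDecomposition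

variable {K V V' : Type*} [Field K] [AddCommGroup V] [Module K V] [AddCommGroup V'] [Module K V']
  {T : Module.End K V} {T' : Module.End K V'}

theorem supIndep (D : IndecDecomposition T) : D.parts.SupIndep fun U => U.1 :=
  iSupIndep_comp_coe_iff_supIndep.1 D.isInternal.submodule_iSupIndep

theorem sup_eq_top (D : IndecDecomposition T) : D.parts.sup (fun U => U.1) = ⊤ := by
  rw [← D.isInternal.submodule_iSup_eq_top, iSup_subtype, ← Finset.sup_eq_iSup]

theorem finrank_range_aeval [FiniteDimensional K V] (D : IndecDecomposition T) (q : K[X]) :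
    Module.finrank K (LinearMap.range (aeval T q)) =
      ∑ U ∈ D.parts, Module.finrank K (LinearMap.range (aeval (restr T U) q)) := by
  have h1 : ∀ U : T.invtSubmodule,
      (LinearMap.range (aeval (restr T U) q)).map U.1.subtype = U.1.map (aeval T q) := by
    intro U
    ext v
    constructor
    · rintro ⟨_, ⟨u, rfl⟩, rfl⟩
      exact ⟨u, u.2, (coe_aeval_restr T U q u).symm⟩
    · rintro ⟨u, hu, rfl⟩
      exact ⟨_, ⟨⟨u, hu⟩, rfl⟩, coe_aeval_restr T U q ⟨u, hu⟩⟩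
  have h2 : LinearMap.range (aeval T q) = D.parts.sup fun U => U.1.map (aeval T q) := by
    rw [LinearMap.range_eq_map, ← D.sup_eq_top, Finset.sup_eq_iSup, Finset.sup_eq_iSup]
    simp only [Submodule.map_iSup]
  have h3 : D.parts.SupIndep fun U => U.1.map (aeval T q) := by
    refine D.supIndep.mono fun U _ => ?_
    change U.1.map (aeval T q) ≤ U.1
    rw [← h1]
    exact Submodule.map_subtype_le _ _
  rw [h2, finrank_finset_sup h3]
  refine Finset.sum_congr rfl fun U _ => ?_
  rw [← h1, Submodule.finrank_map_subtype_eq]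

theorem exists_isCyclicWith [FiniteDimensional K V] (D : IndecDecomposition T)
    {U : T.invtSubmodule} (hU : U ∈ D.parts) :
    ∃ (f : Irr K) (t : ℕ), 0 < t ∧ IsCyclicWith (restr T U) (f.1 ^ t) ∧
      minpoly K (restr T U) = f.1 ^ t := by
  obtain ⟨f, t, ht, h⟩ := (D.indec U hU).isCyclicWith
  exact ⟨f, t, ht, h, h.minpoly_eq (f.2.1.pow t)⟩

theorem _root_.GenType.Irr.pow_inj {f g : Irr K} {t u : ℕ} (ht : 0 < t) (h : f.1 ^ t = g.1 ^ u) :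
    f = g ∧ t = u := by
  have hfg : f = g :=
    Irr.eq_of_dvd (f.2.2.prime.dvd_of_dvd_pow (h ▸ dvd_pow_self _ ht.ne'))
  subst hfg
  exact ⟨rfl, pow_injective_of_not_isUnit f.2.2.not_isUnit f.2.2.ne_zero h⟩

theorem _root_.GenType.Irr.multiplicity_pow_self (f : Irr K) (t : ℕ) :
    multiplicity f.1 (f.1 ^ t) = t :=
  _root_.multiplicity_pow_self f.2.2.ne_zero f.2.2.not_isUnit t

theorem zero_notMem_partition (D : IndecDecomposition T) (f : Irr K) : 0 ∉ D.partition f := by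
  classical
  intro h
  obtain ⟨U, hU, h0⟩ := Multiset.mem_map.1 h
  obtain ⟨-, t, ht, hm⟩ := Finset.mem_filter.1 hU
  rw [hm, f.multiplicity_pow_self] at h0
  exact ht.ne' h0

-- On a summand `K[X] / (f ^ t)` the map `f(T) ^ k` has rank `(t - k) * deg f`, truncated at `0`; on
-- every other summand it is invertible. Thus only the first sum varies with `k`, as
-- `multiset_eq_of_sum_tsub` requires.
open Classical in
theorem finrank_range_aeval_pow [FiniteDimensional K V] (D : IndecDecomposition T) (f : Irr K)
    (k : ℕ) :
    Module.finrank K (LinearMap.range (aeval T (f.1 ^ k))) =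
      ((D.partition f).map fun t => (t - k) * f.1.natDegree).sum +
        ∑ U ∈ D.parts with ¬ ∃ t : ℕ, 0 < t ∧ minpoly K (restr T U) = f.1 ^ t,
          (minpoly K (restr T U)).natDegree := by
  rw [D.finrank_range_aeval, ← Finset.sum_filter_add_sum_filter_not D.parts
    (fun U => ∃ t : ℕ, 0 < t ∧ minpoly K (restr T U) = f.1 ^ t)]
  congr 1
  · rw [partition, Multiset.map_map]
    refine Finset.sum_congr rfl fun U hU => ?_
    obtain ⟨hU, t, ht, hm⟩ := Finset.mem_filter.1 hU
    obtain ⟨g, u, hu, hc, hm'⟩ := D.exists_isCyclicWith hU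
    rw [← hm', hm] at hc
    rw [Function.comp_apply, hm, f.multiplicity_pow_self, ← natDegree_pow]
    refine hc.finrank_range fun q => ?_
    rcases le_total t k with h | h
    · rw [Nat.sub_eq_zero_of_le h, pow_zero]
      exact iff_of_true ((pow_dvd_pow _ h).mul_right _) (one_dvd _)
    · obtain ⟨j, rfl⟩ := Nat.exists_eq_add_of_le h
      rw [pow_add, Nat.add_sub_cancel_left, mul_dvd_mul_iff_left (pow_ne_zero _ f.2.2.ne_zero)]
  · refine Finset.sum_congr rfl fun U hU => ?_
    obtain ⟨hU, hn⟩ := Finset.mem_filter.1 hU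
    obtain ⟨g, u, hu, hc, hm⟩ := D.exists_isCyclicWith hU
    have hgf : g ≠ f := by
      rintro rfl
      exact hn ⟨u, hu, hm⟩
    rw [hm]
    refine hc.finrank_range fun q => ?_
    exact ⟨(Irr.isCoprime hgf).pow.dvd_of_dvd_mul_left, fun h => h.mul_left _⟩

/-- The partitions depend only on the isomorphism class of the endomorphism. -/
theorem partition_eq [FiniteDimensional K V] [FiniteDimensional K V'] (D : IndecDecomposition T)
    (D' : IndecDecomposition T') (e : V ≃ₗ[K] V') (h : ∀ v, e (T v) = T' (e v)) (f : Irr K) :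
    D.partition f = D'.partition f := by
  have h1 : ∀ k, _ := fun k => finrank_range_aeval_eq e h (f.1 ^ k)
  simp only [D.finrank_range_aeval_pow, D'.finrank_range_aeval_pow] at h1
  exact multiset_eq_of_sum_tsub (D.zero_notMem_partition f) (D'.zero_notMem_partition f)
    f.2.2.natDegree_pos h1

theorem generalizedType_congr {D : IndecDecomposition T} {D' : IndecDecomposition T'}
    (h : ∀ f, D.partition f = D'.partition f) : D.generalizedType = D'.generalizedType := by
  have hs : D.finite_support.toFinset = D'.finite_support.toFinset := by
    ext f
    simp [support, h]
  rw [generalizedType, generalizedType, hs]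
  exact Multiset.map_congr rfl fun f _ => by rw [h]

open Classical in
theorem count_partition (D : IndecDecomposition T) (f : Irr K) {t : ℕ} (ht : 0 < t) :
    (D.partition f).count t =
      (D.parts.val.map fun U => minpoly K (restr T U)).count (f.1 ^ t) := by
  rw [partition, Multiset.count_map, Multiset.count_map, ← Finset.filter_val,
    Finset.filter_filter, ← Finset.filter_val]
  congr 2
  refine Finset.filter_congr fun U _ => ?_
  constructor
  · rintro ⟨⟨u, hu, hm⟩, h⟩
    rw [hm, f.multiplicity_pow_self] at h
    rw [hm, h]
  · intro hm
    exact ⟨⟨t, ht, hm.symm⟩, by rw [← hm, f.multiplicity_pow_self]⟩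

theorem count_minpoly_eq_zero [FiniteDimensional K V] [DecidableEq K[X]]
    (D : IndecDecomposition T) {m : K[X]} (hm : ¬ ∃ (f : Irr K) (t : ℕ), 0 < t ∧ m = f.1 ^ t) :
    (D.parts.val.map fun U => minpoly K (restr T U)).count m = 0 := by
  refine Multiset.count_eq_zero_of_notMem fun h => hm ?_
  obtain ⟨U, hU, rfl⟩ := Multiset.mem_map.1 h
  obtain ⟨f, t, ht, -, h⟩ := D.exists_isCyclicWith hU
  exact ⟨f, t, ht, h⟩

/-- Endomorphisms with the same partitions are similar. -/
theorem exists_equiv_of_partition_eq [FiniteDimensional K V] [FiniteDimensional K V']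
    (D : IndecDecomposition T) (D' : IndecDecomposition T')
    (h : ∀ f, D.partition f = D'.partition f) : ∃ e : V ≃ₗ[K] V', ∀ v, e (T v) = T' (e v) := by
  classical
  -- The partitions give the multiplicity of each `f ^ t` among the minimum polynomials of the
  -- summands, and no other polynomials occur, so summands can be matched.
  obtain ⟨σ, hσ⟩ : ∃ σ : D.parts ≃ D'.parts,
      ∀ U, minpoly K (restr T' (σ U).1) = minpoly K (restr T U.1) := by
    apply exists_equiv_of_multiset_map_eq (F := fun U => minpoly K (restr T U))
      (G := fun U => minpoly K (restr T' U))
    ext m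
    by_cases hm : ∃ (f : Irr K) (t : ℕ), 0 < t ∧ m = f.1 ^ t
    · obtain ⟨f, t, ht, rfl⟩ := hm
      have h1 := D.count_partition f ht
      rw [h, D'.count_partition f ht] at h1
      convert h1.symm
    · rw [D.count_minpoly_eq_zero hm, D'.count_minpoly_eq_zero hm]
  have hE : ∀ U : D.parts, ∃ e : U.1.1 ≃ₗ[K] (σ U).1.1,
      ∀ u, e (restr T U.1 u) = restr T' (σ U).1 (e u) := by
    intro U
    obtain ⟨f, t, ht, hc, hm⟩ := D.exists_isCyclicWith U.2
    obtain ⟨g, u, hu, hc', hm'⟩ := D'.exists_isCyclicWith (σ U).2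
    rw [← hm', hσ U, hm] at hc'
    exact hc.exists_equiv hc'
  choose E hE using hE
  have hI : DirectSum.IsInternal fun U : D.parts => U.1.1 := by convert D.isInternal
  have hI' : DirectSum.IsInternal fun U : D.parts => (σ U).1.1 := by
    rw [DirectSum.isInternal_submodule_iff_iSupIndep_and_iSup_eq_top]
    exact ⟨D'.isInternal.submodule_iSupIndep.comp σ.injective,
      (σ.iSup_comp (g := fun U : D'.parts => U.1.1)).trans D'.isInternal.submodule_iSup_eq_top⟩
  let a := LinearEquiv.ofBijective (DirectSum.coeLinearMap fun U : D.parts => U.1.1) hI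
  let b := LinearEquiv.ofBijective (DirectSum.coeLinearMap fun U : D.parts => (σ U).1.1) hI'
  let c : (DirectSum D.parts fun U => U.1.1) ≃ₗ[K] (DirectSum D.parts fun U => (σ U).1.1) :=
    DFinsupp.mapRange.linearEquiv E
  let e : V ≃ₗ[K] V' := (a.symm.trans c).trans b
  have he : ∀ (U : D.parts) (u : U.1.1), e u = E U u := by
    intro U u
    have h1 : a (DirectSum.lof K D.parts (fun U => U.1.1) U u) = u :=
      DirectSum.coeLinearMap_lof _ _ _
    have h2 : c (DirectSum.lof K D.parts (fun U => U.1.1) U u) =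
        DirectSum.lof K D.parts (fun U => (σ U).1.1) U (E U u) :=
      DFinsupp.mapRange_single (hf := fun i => (E i).map_zero)
    have h3 : b (DirectSum.lof K D.parts (fun U => (σ U).1.1) U (E U u)) = E U u :=
      DirectSum.coeLinearMap_lof _ _ _
    change b (c (a.symm u)) = _
    rw [← h1, LinearEquiv.symm_apply_apply, h2, h3]
  refine ⟨e, fun v => ?_⟩
  have hv : v ∈ ⨆ U : D.parts, U.1.1 := by rw [hI.submodule_iSup_eq_top]; trivial
  induction hv using Submodule.iSup_induction' with
  | mem U v hv =>
    have h1 := he U (restr T U.1 ⟨v, hv⟩)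
    rw [hE] at h1
    have h2 := he U ⟨v, hv⟩
    change e (T v) = T' (E U ⟨v, hv⟩) at h1
    rw [h1, ← h2]
  | zero => simp
  | add x y _ _ hx hy => simp [hx, hy]

end IndecDecomposition

/-! ### The effect of a substitution on a decomposition -/

section Substitution

variable {K V : Type*} [Field K] [AddCommGroup V] [Module K V]

theorem Irr.exists_dvd_comp (f : Irr K) (p : K[X]) : ∃ g : Irr K, f.1 ∣ g.1.comp p := by
  obtain ⟨α, hα⟩ := f.exists_root
  have hint : IsIntegral K (aeval α p) := Algebra.IsIntegral.isIntegral _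
  refine ⟨⟨minpoly K (aeval α p), minpoly.monic hint, minpoly.irreducible hint⟩, ?_⟩
  rw [f.dvd_iff hα, aeval_comp, minpoly.aeval]

/-- Both `g` and `g'` are the minimum polynomial of `p(α)`, for `α` a root of `f`. So `p` induces a
map `f ↦ g` on irreducibles. -/
theorem Irr.eq_of_dvd_comp {f g g' : Irr K} {p : K[X]} (h : f.1 ∣ g.1.comp p)
    (h' : f.1 ∣ g'.1.comp p) : g = g' := by
  obtain ⟨α, hα⟩ := f.exists_root
  rw [f.dvd_iff hα, aeval_comp] at h h'
  exact Irr.eq_of_dvd ((g.dvd_iff h).2 h')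

theorem rootsMatch_of_dvd_comp {L : Type*} [Field L] [Algebra K L] {f g : Irr K} {p s : K[X]}
    (h : f.1 ∣ g.1.comp p) (hs : f.1 ∣ s.comp p - X) : RootsMatch L f.1 g.1 := by
  intro α hα
  rw [f.dvd_iff hα, aeval_comp] at h
  rw [f.dvd_iff hα, map_sub, aeval_comp, aeval_X, sub_eq_zero] at hs
  have hmem : ∀ (γ : L) (q : K[X]), aeval γ q ∈ K⟮γ⟯ := fun γ q =>
    algebra_adjoin_le_adjoin K {γ} (aeval_mem_adjoin_singleton K γ)
  refine ⟨aeval α p, h, le_antisymm ?_ ?_⟩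
  · rw [adjoin_simple_le_iff]
    have := hmem (aeval α p) s
    rwa [hs] at this
  · rw [adjoin_simple_le_iff]
    exact hmem α p

/-- Since `g(p) ^ u` kills `S`, the prime `f` divides `g(p)`; then `f ^ t ∣ g(p) ^ t`, so `g ^ t`
kills `S'`. Exponents thus never grow, and an inverse substitution forces equality. -/
theorem dvd_comp_and_le_of_minpoly_eq {S S' : Module.End K V} {p : K[X]} (hp : S' = aeval S p)
    {f g : Irr K} {t u : ℕ} (ht : 0 < t) (hf : minpoly K S = f.1 ^ t)
    (hg : minpoly K S' = g.1 ^ u) : f.1 ∣ g.1.comp p ∧ u ≤ t := by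
  have h1 : f.1 ∣ g.1.comp p := by
    have h2 : f.1 ^ t ∣ (g.1.comp p) ^ u := by
      rw [← hf, ← pow_comp, ← hg]
      apply minpoly.dvd
      rw [aeval_comp, ← hp, minpoly.aeval]
    exact f.2.2.prime.dvd_of_dvd_pow ((dvd_pow_self _ ht.ne').trans h2)
  refine ⟨h1, ?_⟩
  have h3 : g.1 ^ u ∣ g.1 ^ t := by
    rw [← hg]
    apply minpoly.dvd
    rw [hp, ← aeval_comp, pow_comp]
    obtain ⟨c, hc⟩ := pow_dvd_pow_of_dvd h1 t
    rw [hc, ← hf, map_mul, minpoly.aeval, zero_mul]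
  exact (pow_dvd_pow_iff g.2.2.ne_zero g.2.2.not_isUnit).1 h3

theorem mem_invtSubmodule_aeval {T : Module.End K V} {W : Submodule K V}
    (hW : W ∈ T.invtSubmodule) (p : K[X]) : W ∈ (aeval T p).invtSubmodule := by
  rw [Module.End.mem_invtSubmodule_iff_forall_mem_of_mem]
  intro v hv
  rw [← coe_aeval_restr T ⟨W, hW⟩ p ⟨v, hv⟩]
  exact Subtype.property _

theorem restr_aeval {T T' : Module.End K V} {p : K[X]} (hp : T' = aeval T p) {W : Submodule K V}
    (hW : W ∈ T.invtSubmodule) (hW' : W ∈ T'.invtSubmodule) :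
    restr T' ⟨W, hW'⟩ = aeval (restr T ⟨W, hW⟩) p := by
  ext w
  rw [coe_aeval_restr, ← hp]
  rfl

namespace IndecDecomposition

variable {T T' : Module.End K V}

theorem mem_support_iff (D : IndecDecomposition T) (f : Irr K) :
    f ∈ D.support ↔ ∃ U ∈ D.parts, ∃ t : ℕ, 0 < t ∧ minpoly K (restr T U) = f.1 ^ t := by
  classical
  rw [support, Set.mem_ofPred_eq, partition, Ne, Multiset.map_eq_zero, Finset.val_eq_zero,
    ← Ne, ← Finset.nonempty_iff_ne_empty]
  constructor
  · rintro ⟨U, hU⟩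
    obtain ⟨h1, h2⟩ := Finset.mem_filter.1 hU
    exact ⟨U, h1, h2⟩
  · rintro ⟨U, h1, h2⟩
    exact ⟨U, Finset.mem_filter.2 ⟨h1, h2⟩⟩

theorem aeval_eq_zero_of_forall (D : IndecDecomposition T) {q : K[X]}
    (h : ∀ U ∈ D.parts, minpoly K (restr T U) ∣ q) : aeval T q = 0 := by
  rw [← LinearMap.ker_eq_top, eq_top_iff, ← D.sup_eq_top]
  refine Finset.sup_le fun U hU v hv => ?_
  rw [LinearMap.mem_ker, ← coe_aeval_restr T U q ⟨v, hv⟩]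
  obtain ⟨c, hc⟩ := h U hU
  rw [hc, map_mul, minpoly.aeval, zero_mul, LinearMap.zero_apply, Submodule.coe_zero]

/-- A decomposition for `T` is one for any endomorphism with the same invariant subspaces. -/
def transfer (D : IndecDecomposition T)
    (h : ∀ W : Submodule K V, W ∈ T.invtSubmodule ↔ W ∈ T'.invtSubmodule) :
    IndecDecomposition T' where
  parts := D.parts.map (Equiv.subtypeEquivRight h).toEmbedding
  indec := by
    intro U hU
    obtain ⟨U, hU₁, rfl⟩ := Finset.mem_map.1 hU
    obtain ⟨h0, h1⟩ := D.indec U hU₁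
    exact ⟨h0, fun A B => h1 ⟨A.1, (h _).2 A.2⟩ ⟨B.1, (h _).2 B.2⟩⟩
  isInternal := by
    classical
    apply DirectSum.isInternal_submodule_of_iSupIndep_of_iSup_eq_top
    · refine iSupIndep_comp_coe_iff_supIndep.2 ?_
      rw [Finset.supIndep_map]
      exact D.supIndep
    · rw [iSup_subtype, ← Finset.sup_eq_iSup (f := fun U : T'.invtSubmodule => U.1),
        Finset.sup_map]
      exact D.sup_eq_top

theorem mem_transfer_parts (D : IndecDecomposition T)
    (h : ∀ W : Submodule K V, W ∈ T.invtSubmodule ↔ W ∈ T'.invtSubmodule)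
    (U' : T'.invtSubmodule) :
    U' ∈ (D.transfer h).parts ↔ ⟨U'.1, (h _).2 U'.2⟩ ∈ D.parts := by
  constructor
  · intro hU
    obtain ⟨U, hU₁, rfl⟩ := Finset.mem_map.1 hU
    exact hU₁
  · intro hU
    exact Finset.mem_map.2 ⟨_, hU, rfl⟩

variable {p s : K[X]}

theorem mem_invtSubmodule_iff (hp : T' = aeval T p) (hs : T = aeval T' s) (W : Submodule K V) :
    W ∈ T.invtSubmodule ↔ W ∈ T'.invtSubmodule :=
  ⟨fun h => hp ▸ mem_invtSubmodule_aeval h p, fun h => hs ▸ mem_invtSubmodule_aeval h s⟩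

theorem minpoly_restr_dvd (hp : T' = aeval T p) (hs : T = aeval T' s) (U : T.invtSubmodule) :
    minpoly K (restr T U) ∣ s.comp p - X := by
  apply minpoly.dvd
  ext u
  rw [coe_aeval_restr, map_sub, aeval_comp, ← hp, ← hs, aeval_X, sub_self]
  rfl

/-- The effect of a substitution with polynomial inverse on an indecomposable summand. -/
theorem exists_minpoly_restr [FiniteDimensional K V] (D : IndecDecomposition T)
    (hp : T' = aeval T p) (hs : T = aeval T' s) {U : T.invtSubmodule} (hU : U ∈ D.parts)
    (hU' : U.1 ∈ T'.invtSubmodule) :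
    ∃ (f g : Irr K) (t : ℕ), 0 < t ∧ minpoly K (restr T U) = f.1 ^ t ∧
      minpoly K (restr T' ⟨U.1, hU'⟩) = g.1 ^ t ∧ f.1 ∣ g.1.comp p ∧ g.1 ∣ f.1.comp s := by
  obtain ⟨f, t, ht, -, hf⟩ := D.exists_isCyclicWith hU
  have hmem := (D.mem_transfer_parts (mem_invtSubmodule_iff hp hs) ⟨U.1, hU'⟩).2 hU
  obtain ⟨g, u, hu, -, hg⟩ := (D.transfer _).exists_isCyclicWith hmem
  obtain ⟨h1, h2⟩ := dvd_comp_and_le_of_minpoly_eq (restr_aeval hp U.2 hU') ht hf hg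
  obtain ⟨h3, h4⟩ := dvd_comp_and_le_of_minpoly_eq (restr_aeval hs hU' U.2) hu hg hf
  obtain rfl := le_antisymm h2 h4
  exact ⟨f, g, u, hu, hf, hg, h1, h3⟩

/-- A summand belonging to `f` under `T` belongs under `T'` to some irreducible, which
`Irr.eq_of_dvd_comp` identifies as `g`; on that summand `s` recovers `T` from `T'`. -/
theorem dvd_comp_of_mem_support [FiniteDimensional K V] (D : IndecDecomposition T)
    (hp : T' = aeval T p) (hs : T = aeval T' s) {f g : Irr K} (hf : f ∈ D.support)
    (h : f.1 ∣ g.1.comp p) : g.1 ∣ f.1.comp s := by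
  obtain ⟨U, hU, t, ht, hm⟩ := (D.mem_support_iff f).1 hf
  obtain ⟨f', g', t', ht', h1, -, h3, h4⟩ := D.exists_minpoly_restr hp hs hU
    ((mem_invtSubmodule_iff hp hs _).1 U.2)
  obtain ⟨rfl, rfl⟩ := Irr.pow_inj ht (hm.symm.trans h1)
  rwa [Irr.eq_of_dvd_comp h h3]

/-- The summands belonging to `f` under `T` are exactly those belonging to `g` under `T'`, with the
same exponents. -/
theorem partition_transfer [FiniteDimensional K V] (D : IndecDecomposition T)
    (hp : T' = aeval T p) (hs : T = aeval T' s) {f g : Irr K} (hf : f ∈ D.support)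
    (h : f.1 ∣ g.1.comp p) :
    (D.transfer (mem_invtSubmodule_iff hp hs)).partition g = D.partition f := by
  classical
  have key : ∀ U ∈ D.parts, ∀ (hU' : U.1 ∈ T'.invtSubmodule) (t : ℕ), 0 < t →
      (minpoly K (restr T' ⟨U.1, hU'⟩) = g.1 ^ t ↔ minpoly K (restr T U) = f.1 ^ t) := by
    intro U hU hU' t ht
    obtain ⟨f', g', t', ht', h1, h2, h3, h4⟩ := D.exists_minpoly_restr hp hs hU hU'
    rw [h1, h2]
    constructor
    · intro h5
      obtain ⟨rfl, rfl⟩ := Irr.pow_inj ht' h5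
      rw [Irr.eq_of_dvd_comp h4 (D.dvd_comp_of_mem_support hp hs hf h)]
    · intro h5
      obtain ⟨rfl, rfl⟩ := Irr.pow_inj ht' h5
      rw [Irr.eq_of_dvd_comp h3 h]
  have h1 : ((D.transfer (mem_invtSubmodule_iff hp hs)).parts.filter fun U =>
      ∃ t : ℕ, 0 < t ∧ minpoly K (restr T' U) = g.1 ^ t) =
      (D.parts.filter fun U => ∃ t : ℕ, 0 < t ∧ minpoly K (restr T U) = f.1 ^ t).map
        (Equiv.subtypeEquivRight (mem_invtSubmodule_iff hp hs)).toEmbedding := by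
    rw [transfer, Finset.filter_map]
    congr 1
    refine Finset.filter_congr fun U hU => ?_
    exact exists_congr fun t => and_congr_right fun ht =>
      key U hU ((mem_invtSubmodule_iff hp hs _).1 U.2) t ht
  rw [partition, partition]
  have h2 := congrArg Finset.val h1
  rw [Finset.map_val] at h2
  refine (congrArg (Multiset.map _) (Eq.trans (by congr!) h2)).trans ?_
  rw [Multiset.map_map]
  refine Multiset.map_congr (by congr!) fun U hU => ?_
  obtain ⟨hU, t, ht, hm⟩ := Finset.mem_filter.1 hU
  have hm' := (key U hU ((mem_invtSubmodule_iff hp hs _).1 U.2) t ht).2 hm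
  rw [hm, f.multiplicity_pow_self]
  change multiplicity g.1 (minpoly K (restr T' ⟨U.1, _⟩)) = t
  rw [hm', g.multiplicity_pow_self]

theorem exists_of_mem_support_transfer [FiniteDimensional K V] (D : IndecDecomposition T)
    (hp : T' = aeval T p) (hs : T = aeval T' s) {g : Irr K}
    (hg : g ∈ (D.transfer (mem_invtSubmodule_iff hp hs)).support) :
    ∃ f ∈ D.support, f.1 ∣ g.1.comp p := by
  obtain ⟨U', hU', t, ht, hm⟩ := (mem_support_iff _ g).1 hg
  rw [mem_transfer_parts] at hU'
  obtain ⟨f, g', t', ht', h1, h2, h3, h4⟩ := D.exists_minpoly_restr hp hs hU' U'.2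
  obtain ⟨rfl, rfl⟩ := Irr.pow_inj ht (hm.symm.trans h2)
  exact ⟨f, (D.mem_support_iff f).2 ⟨_, hU', t, ht, h1⟩, h3⟩

theorem equivalent_of_dvd_comp [FiniteDimensional K V] (D : IndecDecomposition T)
    (hp : T' = aeval T p) (hs : T = aeval T' s) {f g : Irr K} (hf : f ∈ D.support)
    (h : f.1 ∣ g.1.comp p) : Equivalent f g := by
  -- Stated for arbitrary endomorphisms because it is used twice, the second time with `T`, `T'` and
  -- `p`, `s` exchanged.
  have hdvd : ∀ {T T' : Module.End K V} {p s : K[X]} (D : IndecDecomposition T)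
      (_ : T' = aeval T p) (_ : T = aeval T' s) {f : Irr K} (_ : f ∈ D.support),
      f.1 ∣ s.comp p - X := by
    intro T T' p s D hp hs f hf
    obtain ⟨U, hU, t, ht, hm⟩ := (D.mem_support_iff f).1 hf
    exact (dvd_pow_self _ ht.ne').trans (hm ▸ minpoly_restr_dvd hp hs U)
  have hg : g ∈ (D.transfer (mem_invtSubmodule_iff hp hs)).support := by
    rw [support, Set.mem_ofPred_eq, D.partition_transfer hp hs hf h]
    exact hf
  exact ⟨rootsMatch_of_dvd_comp h (hdvd D hp hs hf),
    rootsMatch_of_dvd_comp (D.dvd_comp_of_mem_support hp hs hf h) (hdvd _ hs hp hg)⟩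

/-- The map `f ↦ g` induced by `p` is a bijection between the supports, injective there because `s`
induces its inverse; it preserves classes and partitions. -/
theorem generalizedType_transfer [FiniteDimensional K V] (D : IndecDecomposition T)
    (hp : T' = aeval T p) (hs : T = aeval T' s) :
    D.generalizedType = (D.transfer (mem_invtSubmodule_iff hp hs)).generalizedType := by
  choose g hg using fun f : Irr K => f.exists_dvd_comp p
  refine Multiset.map_eq_map_of_bij_of_nodup _ _ (Finset.nodup _) (Finset.nodup _)
    (fun f _ => g f) ?_ ?_ ?_ ?_
  · intro f hf
    rw [Finset.mem_val, Set.Finite.mem_toFinset] at hf ⊢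
    rw [support, Set.mem_ofPred_eq, D.partition_transfer hp hs hf (hg f)]
    exact hf
  · intro f hf f' hf' h
    rw [Finset.mem_val, Set.Finite.mem_toFinset] at hf hf'
    have h1 := D.dvd_comp_of_mem_support hp hs hf (hg f)
    rw [h] at h1
    exact Irr.eq_of_dvd_comp h1 (D.dvd_comp_of_mem_support hp hs hf' (hg f'))
  · intro g' hg'
    rw [Finset.mem_val, Set.Finite.mem_toFinset] at hg'
    obtain ⟨f, hf, h⟩ := D.exists_of_mem_support_transfer hp hs hg'
    exact ⟨f, by rwa [Finset.mem_val, Set.Finite.mem_toFinset], Irr.eq_of_dvd_comp (hg f) h⟩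
  · intro f hf
    rw [Finset.mem_val, Set.Finite.mem_toFinset] at hf
    rw [D.partition_transfer hp hs hf (hg f)]
    exact Prod.ext (Quotient.sound (s := irrSetoid K)
      (D.equivalent_of_dvd_comp hp hs hf (hg f))) rfl

end IndecDecomposition

end Substitution

/-! ### Mutually inverse polynomials up to similarity -/

section Similarity

variable {K V : Type*} [Field K] [AddCommGroup V] [Module K V] [FiniteDimensional K V]

/-- If `S` is similar to a polynomial in `T`, and `T` to a polynomial in `S`, then `T` is a
polynomial in any conjugate of `S` that is a polynomial in `T`. -/
theorem exists_eq_aeval_of_conj {T S : Module.End K V} {p q : K[X]} {e₁ e₂ : V ≃ₗ[K] V}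
    (h₁ : ∀ v, e₁ (aeval T p v) = S (e₁ v)) (h₂ : ∀ v, e₂ (aeval S q v) = T (e₂ v)) :
    ∃ s : K[X], T = aeval (aeval T p) s := by
  let e : V ≃ₗ[K] V := e₁.trans e₂
  have he : ∀ v, e (aeval (aeval T p) q v) = T (e v) := fun v => by
    have h3 := aeval_intertwine e₁.toLinearMap h₁ q v
    change e₂ (e₁ _) = T (e₂ (e₁ v))
    rw [← h₂]
    exact congrArg e₂ h3
  have hconj : LinearEquiv.conjAlgEquiv K e (aeval (aeval T p) q) = T := by
    ext v
    obtain ⟨w, rfl⟩ := e.surjective v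
    rw [LinearEquiv.conjAlgEquiv_apply_apply, LinearEquiv.symm_apply_apply, he]
  have hle₁ : Algebra.adjoin K {aeval (aeval T p) q} ≤ Algebra.adjoin K {aeval T p} :=
    Algebra.adjoin_singleton_le (aeval_mem_adjoin_singleton K _)
  have hle₂ : Algebra.adjoin K {aeval T p} ≤ Algebra.adjoin K {T} :=
    Algebra.adjoin_singleton_le (aeval_mem_adjoin_singleton K _)
  have hmap : (Algebra.adjoin K {aeval (aeval T p) q}).map
      (LinearEquiv.conjAlgEquiv K e).toAlgHom = Algebra.adjoin K {T} := by
    rw [AlgHom.map_adjoin, Set.image_singleton]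
    congr 2
  -- Conjugation by `e` maps the smallest algebra of the chain onto the largest, so all three
  -- coincide.
  have hfin : Module.finrank K (Algebra.adjoin K {T}) =
      Module.finrank K (Algebra.adjoin K {aeval (aeval T p) q}) := by
    rw [← hmap]
    exact ((Algebra.adjoin K {aeval (aeval T p) q}).equivMapOfInjective _
      (LinearEquiv.conjAlgEquiv K e).injective).toLinearEquiv.finrank_eq.symm
  have heq : Algebra.adjoin K {aeval (aeval T p) q} = Algebra.adjoin K {T} :=
    Subalgebra.eq_of_le_of_finrank_eq (hle₁.trans hle₂) hfin.symm
  have hT : T ∈ Algebra.adjoin K {aeval T p} :=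
    hle₁ (heq ▸ Algebra.self_mem_adjoin_singleton K T)
  rw [Algebra.adjoin_singleton_eq_range_aeval] at hT
  obtain ⟨s, hs⟩ := hT
  exact ⟨s, hs.symm⟩

namespace IndecDecomposition

variable {V' : Type*} [AddCommGroup V'] [Module K V'] [FiniteDimensional K V']
  {T : Module.End K V} {S : Module.End K V'}

/-- Endomorphisms with the same generalized type are polynomials in one another, up to
similarity, and the polynomials can be chosen mutually inverse. -/
theorem exists_polynomial_of_generalizedType_eq (D : IndecDecomposition T)
    (D' : IndecDecomposition S) (h : D.generalizedType = D'.generalizedType) :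
    ∃ (p s : K[X]) (e : V ≃ₗ[K] V'), T = aeval (aeval T p) s ∧
      ∀ v, e (aeval T p v) = S (e v) := by
  obtain ⟨σ, hσ⟩ := exists_equiv_of_multiset_map_eq h
  have hmem : ∀ f : D.finite_support.toFinset, f.1 ∈ D.support := fun f =>
    D.finite_support.mem_toFinset.1 f.2
  -- `N` bounds every exponent, as `t ≤ t * deg f`.
  let N := D.parts.sup fun U => (minpoly K (restr T U)).natDegree
  obtain ⟨p, s, hps⟩ := exists_simultaneous_comp_inverse
    (fun f : D.finite_support.toFinset => f.1) (fun f => (σ f).1) Subtype.val_injective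
    (Subtype.val_injective.comp σ.injective)
    (fun f => (irrSetoid K).symm (Quotient.exact (s := irrSetoid K) (congrArg Prod.fst (hσ f)))) N
  have hs : T = aeval (aeval T p) s := by
    have h0 : aeval T (s.comp p - X) = 0 := by
      refine D.aeval_eq_zero_of_forall fun U hU => ?_
      obtain ⟨f, t, ht, -, hm⟩ := D.exists_isCyclicWith hU
      have hf : f ∈ D.finite_support.toFinset :=
        D.finite_support.mem_toFinset.2 ((D.mem_support_iff f).2 ⟨U, hU, t, ht, hm⟩)
      have htN : t ≤ N := by
        have h1 : (minpoly K (restr T U)).natDegree ≤ N :=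
          Finset.le_sup (f := fun U => (minpoly K (restr T U)).natDegree) hU
        rw [hm, natDegree_pow] at h1
        exact (Nat.le_mul_of_pos_right t f.2.2.natDegree_pos).trans h1
      rw [hm]
      exact (pow_dvd_pow _ htN).trans (hps ⟨f, hf⟩).2
    rw [map_sub, aeval_comp, aeval_X, sub_eq_zero] at h0
    exact h0.symm
  have hpart : ∀ f : D.finite_support.toFinset,
      (D.transfer (mem_invtSubmodule_iff rfl hs)).partition (σ f).1 = D'.partition (σ f).1 := by
    intro f
    rw [D.partition_transfer rfl hs (hmem f) (hps f).1]
    exact (congrArg Prod.snd (hσ f)).symm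
  -- An irreducible in either support is some `σ f`, where the partitions agree; elsewhere both are
  -- empty.
  obtain ⟨e, he⟩ := exists_equiv_of_partition_eq
    (D.transfer (mem_invtSubmodule_iff rfl hs)) D' fun g => by
      by_cases hg : g ∈ D'.support
      · obtain ⟨f, hf⟩ := σ.surjective ⟨g, D'.finite_support.mem_toFinset.2 hg⟩
        have := hpart f
        rwa [hf] at this
      by_cases hg' : g ∈ (D.transfer (mem_invtSubmodule_iff rfl hs)).support
      · obtain ⟨f, hf, hd⟩ := D.exists_of_mem_support_transfer rfl hs hg'
        have hf' := D.finite_support.mem_toFinset.2 hf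
        rw [Irr.eq_of_dvd_comp hd (hps ⟨f, hf'⟩).1]
        exact hpart ⟨f, hf'⟩
      · rw [support, Set.mem_ofPred_eq, not_not] at hg hg'
        rw [hg, hg']
  exact ⟨p, s, e, hs, he⟩

end IndecDecomposition

end Similarity

/-! ### Matrices acting on row vectors -/

section Matrices

variable {K : Type*} [Field K] {d : ℕ}

/-- The action on row vectors reverses products, which is harmless because polynomials in `X`
commute with `X`. -/
theorem aeval_vecMulLinear (X : Matrix (Fin d) (Fin d) K) (p : K[X]) :
    aeval (A := Module.End K (Fin d → K)) X.vecMulLinear p = (aeval X p).vecMulLinear := by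
  induction p using Polynomial.induction_on with
  | C a =>
    ext v
    simp [Algebra.algebraMap_eq_smul_one]
  | add p q hp hq =>
    refine LinearMap.ext fun v => ?_
    rw [map_add, map_add, hp, hq]
    exact (Matrix.vecMul_add (aeval X p) (aeval X q) v).symm
  | monomial n a ih =>
    have h1 : C a * Polynomial.X ^ (n + 1) = Polynomial.X * (C a * Polynomial.X ^ n) := by ring
    have h2 : aeval X (C a * Polynomial.X ^ (n + 1)) = X * aeval X (C a * Polynomial.X ^ n) := by
      rw [h1, map_mul, aeval_X]
    have h3 : aeval (A := Module.End K (Fin d → K)) X.vecMulLinear (C a * Polynomial.X ^ (n + 1)) =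
        aeval (A := Module.End K (Fin d → K)) X.vecMulLinear (C a * Polynomial.X ^ n) *
          X.vecMulLinear := by
      rw [h1, mul_comm, map_mul, aeval_X]
    refine LinearMap.ext fun v => ?_
    rw [h2, h3, ih]
    exact Matrix.vecMul_vecMul v X (aeval X (C a * Polynomial.X ^ n))

theorem isConj_iff_exists_equiv (X Y : Matrix (Fin d) (Fin d) K) :
    IsConj X Y ↔ ∃ e : (Fin d → K) ≃ₗ[K] (Fin d → K),
      ∀ v, e (X.vecMulLinear v) = Y.vecMulLinear (e v) := by
  constructor
  · rintro ⟨c, hc⟩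
    have h1 : X * (↑c⁻¹ : Matrix (Fin d) (Fin d) K) = (↑c⁻¹ : Matrix (Fin d) (Fin d) K) * Y := by
      rw [Units.mul_inv_eq_iff_eq_mul, mul_assoc, ← hc.eq, Units.inv_mul_cancel_left]
    -- From `c * X = Y * c` and the right action, the intertwiner is `v ↦ v * c⁻¹`.
    refine ⟨LinearEquiv.ofLinearMap (Matrix.vecMulLinear (↑c⁻¹ : Matrix (Fin d) (Fin d) K))
      (Matrix.vecMulLinear (c : Matrix (Fin d) (Fin d) K)) ?_ ?_, fun v => ?_⟩
    · refine LinearMap.ext fun v => ?_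
      rw [LinearMap.comp_apply, Matrix.vecMulLinear_apply, Matrix.vecMulLinear_apply,
        Matrix.vecMul_vecMul, Units.mul_inv, Matrix.vecMul_one, LinearMap.id_apply]
    · refine LinearMap.ext fun v => ?_
      rw [LinearMap.comp_apply, Matrix.vecMulLinear_apply, Matrix.vecMulLinear_apply,
        Matrix.vecMul_vecMul, Units.inv_mul, Matrix.vecMul_one, LinearMap.id_apply]
    · simp only [LinearEquiv.coe_ofLinearMap, Matrix.vecMulLinear_apply]
      rw [Matrix.vecMul_vecMul, Matrix.vecMul_vecMul, h1]
  · rintro ⟨e, he⟩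
    let C := LinearMap.toMatrixRight' e.toLinearMap
    let C' := LinearMap.toMatrixRight' e.symm.toLinearMap
    have hC : ∀ v, Matrix.vecMul v C = e v := fun v =>
      LinearMap.congr_fun (LinearMap.toMatrixRight'.symm_apply_apply e.toLinearMap) v
    have hC' : ∀ v, Matrix.vecMul v C' = e.symm v := fun v =>
      LinearMap.congr_fun (LinearMap.toMatrixRight'.symm_apply_apply e.symm.toLinearMap) v
    have hext : ∀ {A B : Matrix (Fin d) (Fin d) K},
        (∀ v, Matrix.vecMul v A = Matrix.vecMul v B) → A = B := fun {A B} h =>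
      LinearMap.toMatrixRight'.symm.injective (LinearMap.ext h)
    have h1 : C * C' = 1 := hext fun v => by
      rw [← Matrix.vecMul_vecMul, hC, hC', e.symm_apply_apply, Matrix.vecMul_one]
    have h2 : C' * C = 1 := hext fun v => by
      rw [← Matrix.vecMul_vecMul, hC, hC', e.apply_symm_apply, Matrix.vecMul_one]
    have h3 : X * C = C * Y := hext fun v => by
      rw [← Matrix.vecMul_vecMul, ← Matrix.vecMul_vecMul, hC, hC]
      exact he v
    refine ⟨⟨C', C, h2, h1⟩, ?_⟩
    change C' * X = Y * C'
    calc C' * X = C' * (X * C) * C' := by rw [mul_assoc, mul_assoc, h1, mul_one]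
      _ = Y * C' := by rw [h3, ← mul_assoc, h2, one_mul]

end Matrices

end GenType

theorem theorem4p3 {K : Type*} [Field K] {d : ℕ} (X Y : Matrix (Fin d) (Fin d) K) :
    GenType.generalizedType X = GenType.generalizedType Y ↔
      ∃ p q : Polynomial K,
        IsConj (Polynomial.aeval X p) Y ∧ IsConj (Polynomial.aeval Y q) X := by
  simp only [GenType.isConj_iff_exists_equiv, ← GenType.aeval_vecMulLinear]
  constructor
  · intro h
    obtain ⟨p, s, e, hs, he⟩ :=
      GenType.IndecDecomposition.exists_polynomial_of_generalizedType_eq _ _ h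
    -- The inverse substitution serves as `q`: `e` carries `s(p(T)) = T` to `s(S)`.
    refine ⟨p, s, ⟨e, he⟩, e.symm, fun v => ?_⟩
    obtain ⟨w, rfl⟩ := e.surjective v
    have h1 := GenType.aeval_intertwine e.toLinearMap he s w
    rw [← hs] at h1
    rw [e.symm_apply_apply, LinearEquiv.symm_apply_eq]
    exact h1.symm
  · rintro ⟨p, q, ⟨e₁, h₁⟩, e₂, h₂⟩
    obtain ⟨s, hs⟩ := GenType.exists_eq_aeval_of_conj h₁ h₂
    -- The transferred decomposition belongs to `p(X)`; its partitions equal those of the chosen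
    -- decomposition of `Y` by similarity.
    exact ((GenType.decomposition X).generalizedType_transfer rfl hs).trans
      (GenType.IndecDecomposition.generalizedType_congr
        (GenType.IndecDecomposition.partition_eq _ _ e₁ h₁))
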